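/- Let $U=[n]$. An instance of Bernoulli stochastic probing with XOS objective consists of: * probabilities $p_1,\dots,p_n\in[0,1]$; element $i\in U$ is active with probability $p_i$, independently of the others; * a nonempty prefix-closed constraint $\mathcal F$, that is, a family of finite sequences of distinct elements of $U$ containing all prefixes of each of its members; * an XOS objective $f:2^U\to\mathbb R_{\ge 0}$, that is, there are finitely many (at least one) weight vectors $w^{(1)},\dots,w^{(W)}\in\mathbb R_{\ge 0}^U$ with $f(S)=\max_{k\in[W]}\sum_{j\in S}w^{(k)}_j$ for all $S\subseteq U$. An adaptive strategy is a finite binary decision tree whose internal nodes are labelled by elements of $U$. At a node labelled $i$ the element $i$ is probed, and the Yes arc is followed if $i$ is active (probability $p_i$), the No arc otherwise (probability $1-p_i$). The sequence of labels on every root-to-leaf path must belong to $\mathcal F$. The expected reward of the strategy is $\mathbb E[f(A)]$, where $A$ is the set of active elements on the path to the random leaf that is reached. A non-adaptive strategy fixes a sequence $P\in\mathcal F$ in advance, and its expected reward is $\mathbb E[f(\mathrm{Ac}(P))]$, where $\mathrm{Ac}(P)$ is the random set of active elements of $P$. The adaptivity gap of the instance is the ratio of the largest expected reward of an adaptive strategy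 to the largest expected reward of a non-adaptive strategy (with $0/0=0$ and $a/0=\infty$ for $a>0$). Let $\Lambda_{\mathrm{xos}}(n,r)$ be the supremum of the adaptivity gap over all such instances on $U=[n]$ with $\max_{F\in\mathcal F}|F|\le r$. Then $$\Lambda_{\mathrm{xos}}(n,r)=O\!\left(\log r\cdot\frac{\log n}{\log\log n}\right)\qquad(2\le r\le n),$$ that is, there is an absolute constant $C>0$ such that for all integers $n\ge 3$ and $2\le r\le n$, $$\Lambda_{\mathrm{xos}}(n,r)\le C\,\log_2 r\cdot\frac{\log_2 n}{\log_2\log_2 n}.$$ -/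

import Mathlib

open scoped ENNReal

namespace StochasticProbing

/-- A (deterministic) adaptive strategy tree over the ground set `U`. An internal node represents
an element and has a Yes-subtree (element active) and a No-subtree (element inactive); a leaf
represents no element and ends the probing. -/
inductive StrategyTree (U : Type) : Type where
  | leaf : StrategyTree U
  | node (elt : U) (yes no : StrategyTree U) : StrategyTree U

/-- The leaves of a tree, each given by its root-to-leaf path: the list of the elements met from
the root on, each with the arc taken (`true` for Yes, `false` for No). -/
def StrategyTree.leaves {U : Type} : StrategyTree U → List (List (U × Bool))
  | .leaf => [[]]
  | .node i y n => (y.leaves.map fun l => (i, true) :: l) ++ (n.leaves.map fun l => (i, false) :: l)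

/-- The sequence of elements probed on the way to the leaf `l`. -/
def probedSeq {U : Type} (l : List (U × Bool)) : List U := l.map Prod.fst

/-- The set of active elements on the way to the leaf `l`. -/
def activeSet {U : Type} [DecidableEq U] (l : List (U × Bool)) : Finset U :=
  ((l.filter fun a => a.2).map Prod.fst).toFinset

/-- The probability of ending in the leaf `l`: at a node of element `i` the Yes arc is followed with
probability `p i` and the No arc with probability `1 - p i`. -/
def leafProb {U : Type} (p : U → ℝ) (l : List (U × Bool)) : ℝ :=
  (l.map fun a => if a.2 then p a.1 else 1 - p a.1).prod

/-- The expected reward of the adaptive strategy `T`: the expectation, over a random leaf, of the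
value of the set of active elements. -/
def adaptiveReward {U : Type} [DecidableEq U] (p : U → ℝ) (f : Finset U → ℝ)
    (T : StrategyTree U) : ℝ :=
  (T.leaves.map fun l => leafProb p l * f (activeSet l)).sum

/-- The expected reward `𝔼 [f (Ac(P))]` of the non-adaptive strategy that probes the set `P`, each
element `i ∈ P` being active independently with probability `p i`. -/
def nonadaptiveReward {U : Type} [DecidableEq U] (p : U → ℝ) (f : Finset U → ℝ)
    (P : Finset U) : ℝ :=
  ∑ A ∈ P.powerset, ((∏ i ∈ A, p i) * ∏ i ∈ P \ A, (1 - p i)) * f A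

/-- A prefix-closed feasibility constraint: a nonempty family of sequences of distinct elements that
contains every prefix of each of its members. -/
structure IsPrefixClosedConstraint {U : Type} (F : Set (List U)) : Prop where
  nonempty : F.Nonempty
  nodup : ∀ P ∈ F, P.Nodup
  prefix_mem : ∀ P ∈ F, ∀ Q : List U, Q <+: P → Q ∈ F

/-- A tree is feasible if each of its root-to-leaf paths probes a sequence in `F`. -/
def StrategyTree.IsFeasible {U : Type} (F : Set (List U)) (T : StrategyTree U) : Prop :=
  ∀ l ∈ T.leaves, probedSeq l ∈ F

/-- XOS (max-of-sums) set functions: the pointwise maximum of finitely many (at least one) additive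
functions with nonnegative weights. -/
def IsXOS {U : Type} (f : Finset U → ℝ) : Prop :=
  ∃ (W : ℕ) (w : Fin W → U → ℝ), (∀ k j, 0 ≤ w k j) ∧
    ∀ S : Finset U, IsGreatest (Set.range fun k => ∑ j ∈ S, w k j) (f S)

/-- The expected reward of an optimal adaptive strategy. -/
noncomputable def optAdaptive {U : Type} [DecidableEq U] (p : U → ℝ) (F : Set (List U))
    (f : Finset U → ℝ) : ℝ≥0∞ :=
  ⨆ (T : StrategyTree U) (_ : T.IsFeasible F), ENNReal.ofReal (adaptiveReward p f T)

/-- The expected reward of an optimal non-adaptive strategy. -/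
noncomputable def optNonadaptive {U : Type} [DecidableEq U] (p : U → ℝ) (F : Set (List U))
    (f : Finset U → ℝ) : ℝ≥0∞ :=
  ⨆ (P : List U) (_ : P ∈ F), ENNReal.ofReal (nonadaptiveReward p f P.toFinset)

/-- The adaptivity gap of an instance. In `ℝ≥0∞` one has `a / 0 = ∞` for `a ≠ 0`, and `0 / 0 = 0`
(an instance in which no strategy earns anything). -/
noncomputable def adaptivityGap {U : Type} [DecidableEq U] (p : U → ℝ) (F : Set (List U))
    (f : Finset U → ℝ) : ℝ≥0∞ :=
  optAdaptive p F f / optNonadaptive p F f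

/-- `Λ_xos(n, r)`: the supremum of the adaptivity gap over all Bernoulli stochastic probing instances
on a ground set of `n` elements with an XOS objective and a prefix-closed constraint all of whose
sequences have length at most `r`. -/
noncomputable def xosGap (n r : ℕ) : ℝ≥0∞ :=
  sSup {g : ℝ≥0∞ | ∃ (p : Fin n → ℝ) (F : Set (List (Fin n))) (f : Finset (Fin n) → ℝ),
    (∀ i, p i ∈ Set.Icc (0 : ℝ) 1) ∧ IsPrefixClosedConstraint F ∧ (∀ P ∈ F, P.length ≤ r) ∧
    IsXOS f ∧ g = adaptivityGap p F f}

end StochasticProbing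

open scoped ENNReal

namespace StochasticProbing


/-! ### Non-adaptive rewards -/

/-! Let `M` bound every non-adaptive reward, and set `θ = M / r`. Cut the weights realising `f` on
the active set into three kinds (`xos_le_layers`). Light weights contribute at most `r * θ = M` in
all. Elements with singleton value at least `2 * M` contribute at most `2 * M` in expectation
(`probedTotal_large_le`). In between lie `O(log r)` dyadic classes, and in each one `f` is replaced
by a rank-like counting function, so it remains to lose only `O(log n / log log n)` per class
(`treeMean_rankLike_le`).

For a rank-like `g`, take the active set `B` counted at a leaf. A backward scan of the path extracts
advice `R ⊆ B` such that every other element of `B` is boosted: its marginal value over `R` and the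
active part of the earlier probes is at least `1 / 2`. A potential argument gives `|R| + β ≤ 2 * M`,
where `β` is the total probability of the boosted elements on the path (`exists_advice`). So many
active elements means few advice elements or far more boosted activity than its mean `β`.

For fixed `R`, boostedness is known before the element is probed, so the likelihood ratio that makes
boosted elements `L` times as likely has mean at most 1 (`treeMean_pathWeight_le_one`). Averaging
over all `R` with weights `N⁻¹ ^ |R|`, where `N` is the size of the ground set, and taking
logarithms gives `log L * 𝔼 g ≤ 2 * M * (log L + L + log N)`; the choice `L = log₂ n` balances the
terms. -/

lemma nonadaptiveReward_empty {U : Type} [DecidableEq U] (p : U → ℝ) (f : Finset U → ℝ) :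
    nonadaptiveReward p f ∅ = f ∅ := by
  simp [nonadaptiveReward]

lemma nonadaptiveReward_insert {U : Type} [DecidableEq U] (p : U → ℝ) (f : Finset U → ℝ)
    {i : U} {P : Finset U} (hi : i ∉ P) :
    nonadaptiveReward p f (insert i P) =
      p i * nonadaptiveReward p (fun A => f (insert i A)) P +
        (1 - p i) * nonadaptiveReward p f P := by
  unfold nonadaptiveReward
  rw [Finset.sum_powerset_insert hi, add_comm, Finset.mul_sum, Finset.mul_sum]
  congr 1
  · refine Finset.sum_congr rfl fun A hA => ?_
    have hiA : i ∉ A := fun h => hi (Finset.mem_powerset.1 hA h)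
    rw [Finset.prod_insert hiA, Finset.insert_sdiff_insert, Finset.sdiff_insert_of_notMem hi]
    ring
  · refine Finset.sum_congr rfl fun A hA => ?_
    have hiA : i ∉ A := fun h => hi (Finset.mem_powerset.1 hA h)
    rw [Finset.insert_sdiff_of_notMem _ hiA, Finset.prod_insert (by simp [hi])]
    ring

lemma nonadaptiveReward_mono {U : Type} [DecidableEq U] {p : U → ℝ}
    (hp : ∀ i, p i ∈ Set.Icc (0 : ℝ) 1) {f g : Finset U → ℝ} (hfg : ∀ A, f A ≤ g A) (P : Finset U) :
    nonadaptiveReward p f P ≤ nonadaptiveReward p g P := by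
  refine Finset.sum_le_sum fun A _ => mul_le_mul_of_nonneg_left (hfg A) ?_
  exact mul_nonneg (Finset.prod_nonneg fun i _ => (hp i).1)
    (Finset.prod_nonneg fun i _ => sub_nonneg.2 (hp i).2)

lemma nonadaptiveReward_const_mul {U : Type} [DecidableEq U] (p : U → ℝ) (c : ℝ) (f : Finset U → ℝ)
    (P : Finset U) :
    nonadaptiveReward p (fun A => c * f A) P = c * nonadaptiveReward p f P := by
  unfold nonadaptiveReward
  rw [Finset.mul_sum]
  exact Finset.sum_congr rfl fun A _ => by ring

lemma nonadaptiveReward_const {U : Type} [DecidableEq U] (p : U → ℝ) (c : ℝ) (P : Finset U) :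
    nonadaptiveReward p (fun _ => c) P = c := by
  induction P using Finset.induction_on with
  | empty => exact nonadaptiveReward_empty p _
  | insert i P hi ih => rw [nonadaptiveReward_insert p _ hi, ih]; ring

/-- Probing one more element never lowers the reward of a monotone objective. -/
lemma nonadaptiveReward_le_insert {U : Type} [DecidableEq U] {p : U → ℝ}
    (hp : ∀ i, p i ∈ Set.Icc (0 : ℝ) 1) {f : Finset U → ℝ} (hf : Monotone f) {i : U}
    {P : Finset U} (hi : i ∉ P) :
    nonadaptiveReward p f P ≤ nonadaptiveReward p f (insert i P) := by
  rw [nonadaptiveReward_insert p f hi]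
  have := nonadaptiveReward_mono hp (f := f) (g := fun A => f (insert i A))
    (fun A => hf (Finset.subset_insert i A)) P
  nlinarith [(hp i).1]

lemma nonadaptiveReward_le_union {U : Type} [DecidableEq U] {p : U → ℝ}
    (hp : ∀ i, p i ∈ Set.Icc (0 : ℝ) 1) {f : Finset U → ℝ} (hf : Monotone f) (P Q : Finset U) :
    nonadaptiveReward p f P ≤ nonadaptiveReward p f (P ∪ Q) := by
  induction Q using Finset.induction_on with
  | empty => simp
  | insert i Q _ ih =>
    rw [Finset.union_insert]
    by_cases h : i ∈ P ∪ Q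
    · rwa [Finset.insert_eq_of_mem h]
    · exact ih.trans (nonadaptiveReward_le_insert hp hf h)

/-! ### Expectations over the leaves of a strategy tree -/

/-- The expectation of `φ` over the random leaf reached by `T`. -/
def treeMean {U : Type} (p : U → ℝ) (φ : List (U × Bool) → ℝ) (T : StrategyTree U) : ℝ :=
  (T.leaves.map fun l => leafProb p l * φ l).sum

lemma treeMean_leaf {U : Type} (p : U → ℝ) (φ : List (U × Bool) → ℝ) :
    treeMean p φ .leaf = φ [] := by
  simp [treeMean, StrategyTree.leaves, leafProb]

lemma treeMean_node {U : Type} (p : U → ℝ) (φ : List (U × Bool) → ℝ) (i : U)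
    (y n : StrategyTree U) :
    treeMean p φ (.node i y n) =
      p i * treeMean p (fun l => φ ((i, true) :: l)) y +
        (1 - p i) * treeMean p (fun l => φ ((i, false) :: l)) n := by
  simp [treeMean, StrategyTree.leaves, leafProb, Function.comp_def, mul_assoc,
    List.sum_map_mul_left]

lemma leafProb_nonneg {U : Type} {p : U → ℝ} (hp : ∀ i, p i ∈ Set.Icc (0 : ℝ) 1)
    (l : List (U × Bool)) : 0 ≤ leafProb p l := by
  refine List.prod_nonneg fun x hx => ?_
  obtain ⟨a, -, rfl⟩ := List.mem_map.1 hx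
  split_ifs
  · exact (hp _).1
  · exact sub_nonneg.2 (hp _).2

lemma treeMean_mono {U : Type} {p : U → ℝ} (hp : ∀ i, p i ∈ Set.Icc (0 : ℝ) 1)
    {φ ψ : List (U × Bool) → ℝ} {T : StrategyTree U} (h : ∀ l ∈ T.leaves, φ l ≤ ψ l) :
    treeMean p φ T ≤ treeMean p ψ T :=
  List.sum_le_sum fun l hl => mul_le_mul_of_nonneg_left (h l hl) (leafProb_nonneg hp l)

lemma treeMean_add {U : Type} (p : U → ℝ) (φ ψ : List (U × Bool) → ℝ) (T : StrategyTree U) :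
    treeMean p (fun l => φ l + ψ l) T = treeMean p φ T + treeMean p ψ T := by
  simp only [treeMean, mul_add, List.sum_map_add]

lemma treeMean_const_mul {U : Type} (p : U → ℝ) (c : ℝ) (φ : List (U × Bool) → ℝ)
    (T : StrategyTree U) : treeMean p (fun l => c * φ l) T = c * treeMean p φ T := by
  simp only [treeMean, mul_left_comm _ c, List.sum_map_mul_left]

lemma treeMean_const {U : Type} (p : U → ℝ) (c : ℝ) (T : StrategyTree U) :
    treeMean p (fun _ => c) T = c := by
  induction T with
  | leaf => exact treeMean_leaf p _
  | node i y n hy hn => rw [treeMean_node, hy, hn]; ring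

lemma treeMean_sum {U ι : Type} (p : U → ℝ) (s : Finset ι)
    (φ : ι → List (U × Bool) → ℝ) (T : StrategyTree U) :
    treeMean p (fun l => ∑ j ∈ s, φ j l) T = ∑ j ∈ s, treeMean p (φ j) T := by
  classical
  induction s using Finset.induction_on with
  | empty => simpa using treeMean_const p 0 T
  | insert j s hj ih => simp only [Finset.sum_insert hj, treeMean_add, ih]

lemma activeSet_cons {U : Type} [DecidableEq U] (i : U) (a : Bool) (l : List (U × Bool)) :
    activeSet ((i, a) :: l) = if a then insert i (activeSet l) else activeSet l := by
  cases a <;> simp [activeSet]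

lemma activeSet_subset_probedSeq {U : Type} [DecidableEq U] (l : List (U × Bool)) :
    activeSet l ⊆ (probedSeq l).toFinset := by
  intro i
  simp only [activeSet, probedSeq, List.mem_toFinset, List.mem_map, List.mem_filter]
  rintro ⟨a, ⟨ha, -⟩, rfl⟩
  exact ⟨a, ha, rfl⟩

/-! ### Elements of large singleton value -/

/-- The total of `c` over the elements of `l`. -/
def probedTotal {U : Type} (c : U → ℝ) (l : List (U × Bool)) : ℝ :=
  (l.map fun a => c a.1).sum

/-- The total of `c` over the active elements of `l`. -/
def activeTotal {U : Type} (c : U → ℝ) (l : List (U × Bool)) : ℝ :=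
  (l.map fun a => if a.2 then c a.1 else 0).sum

/-- Each element is active with probability `p i` independently of the path leading to its node, so
a Wald-type identity holds. -/
lemma treeMean_activeTotal {U : Type} (p c : U → ℝ) (T : StrategyTree U) :
    treeMean p (activeTotal c) T = treeMean p (probedTotal fun i => p i * c i) T := by
  induction T with
  | leaf => simp [treeMean_leaf, activeTotal, probedTotal]
  | node i y n hy hn =>
    have h₁ : ∀ (a : Bool), (fun l => activeTotal c ((i, a) :: l)) =
        fun l => (if a then c i else 0) + activeTotal c l := fun a => by
      funext l; simp [activeTotal]
    have h₂ : ∀ (a : Bool), (fun l => probedTotal (fun i => p i * c i) ((i, a) :: l)) =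
        fun l => p i * c i + probedTotal (fun i => p i * c i) l := fun a => by
      funext l; simp [probedTotal]
    simp only [treeMean_node, h₁, h₂, treeMean_add, treeMean_const, hy, hn]
    simp
    ring

lemma sum_activeSet_le_activeTotal {U : Type} [DecidableEq U] {c : U → ℝ} (hc : ∀ i, 0 ≤ c i)
    (l : List (U × Bool)) : ∑ i ∈ activeSet l, c i ≤ activeTotal c l := by
  induction l with
  | nil => simp [activeSet, activeTotal]
  | cons a l ih =>
    obtain ⟨i, a⟩ := a
    have h : activeTotal c ((i, a) :: l) = (if a then c i else 0) + activeTotal c l := by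
      simp [activeTotal]
    rw [activeSet_cons, h]
    cases a
    · simpa using ih
    · by_cases hi : i ∈ activeSet l
      · simpa [hi] using ih.trans (le_add_of_nonneg_left (hc i))
      · simpa [Finset.sum_insert hi] using ih

/-- Elements of singleton value at least twice the non-adaptive reward contribute at most twice
the non-adaptive reward in expectation. -/
lemma probedTotal_large_le {U : Type} [DecidableEq U] {p : U → ℝ}
    (hp : ∀ i, p i ∈ Set.Icc (0 : ℝ) 1) {f : Finset U → ℝ} (hf : Monotone f) {M : ℝ}
    (l : List (U × Bool)) (P : Finset U) (hl : (probedSeq l).Nodup)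
    (hP : ∀ i ∈ probedSeq l, i ∉ P)
    (hM : nonadaptiveReward p f (P ∪ (probedSeq l).toFinset) ≤ M) :
    nonadaptiveReward p f P +
      probedTotal (fun i => p i * if 2 * M ≤ f {i} then f {i} else 0) l / 2 ≤ M := by
  induction l generalizing P with
  | nil => simpa [probedTotal, probedSeq] using hM
  | cons a l ih =>
    obtain ⟨i, a⟩ := a
    simp only [probedSeq, List.map_cons, List.nodup_cons] at hl
    have hiP : i ∉ P := hP i (by simp [probedSeq])
    have hPM := (nonadaptiveReward_le_union hp hf P _).trans hM
    have key := ih (insert i P) hl.2 (fun j hj => by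
        have hj' := hP j (by simp only [probedSeq, List.map_cons, List.mem_cons]; exact Or.inr hj)
        simp only [Finset.mem_insert, not_or]
        exact ⟨fun h => hl.1 (h ▸ hj), hj'⟩)
      (by simpa [probedSeq, Finset.insert_union] using hM)
    have hmono := nonadaptiveReward_le_insert hp hf hiP
    have hcons : probedTotal (fun i => p i * if 2 * M ≤ f {i} then f {i} else 0) ((i, a) :: l) =
        p i * (if 2 * M ≤ f {i} then f {i} else 0) +
          probedTotal (fun i => p i * if 2 * M ≤ f {i} then f {i} else 0) l := by
      simp [probedTotal]
    rw [hcons]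
    split_ifs with h
    -- The marginal of `i` is at least `f {i}` minus the current reward, hence at least `f {i} - M ≥
    -- f {i} / 2`.
    · have h1 : f {i} ≤ nonadaptiveReward p (fun A => f (insert i A)) P := by
        rw [← nonadaptiveReward_const p (f {i}) P]
        exact nonadaptiveReward_mono hp (fun A => hf (by simp)) P
      have h2 := nonadaptiveReward_insert p f hiP
      nlinarith [(hp i).1]
    · linarith

/-! ### Boosted elements -/

/-- The element `i` is boosted, with respect to the probed set `P` and the advice `R`, if it raises
the expected value of `R` together with the active elements of `P` by at least `1 / 2`. -/
def IsBoosted {U : Type} [DecidableEq U] (p : U → ℝ) (g : Finset U → ℝ) (R P : Finset U)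
    (i : U) : Prop :=
  1 / 2 ≤ nonadaptiveReward p (fun A => g (insert i (A ∪ R))) P -
    nonadaptiveReward p (fun A => g (A ∪ R)) P

open Classical in
/-- The likelihood-ratio weight of a path when boosted elements are made `L` times as likely to be
active. Advice elements are dropped as they are probed. -/
noncomputable def pathWeight {U : Type} [DecidableEq U] (p : U → ℝ) (g : Finset U → ℝ) (L : ℝ) :
    Finset U → Finset U → List (U × Bool) → ℝ
  | _, _, [] => 1
  | R, P, (i, a) :: l =>
    (if IsBoosted p g (R.erase i) P i then
      (if a then L else 1) * Real.exp (-((L - 1) * p i)) else 1) *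
      pathWeight p g L (R.erase i) (insert i P) l

lemma pathWeight_nonneg {U : Type} [DecidableEq U] (p : U → ℝ) (g : Finset U → ℝ) {L : ℝ}
    (hL : 1 ≤ L) (R P : Finset U) (l : List (U × Bool)) : 0 ≤ pathWeight p g L R P l := by
  induction l generalizing R P with
  | nil => simp [pathWeight]
  | cons a l ih =>
    obtain ⟨i, a⟩ := a
    refine mul_nonneg ?_ (ih _ _)
    split_ifs <;> positivity

/-- The weight is a supermartingale along the tree: whether a node is boosted depends only on `R`
and the earlier probes, not on the outcome at the node. -/
lemma treeMean_pathWeight_le_one {U : Type} [DecidableEq U] {p : U → ℝ}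
    (hp : ∀ i, p i ∈ Set.Icc (0 : ℝ) 1) (g : Finset U → ℝ) {L : ℝ} (hL : 1 ≤ L)
    (R P : Finset U) (T : StrategyTree U) : treeMean p (pathWeight p g L R P) T ≤ 1 := by
  induction T generalizing R P with
  | leaf => simp [treeMean_leaf, pathWeight]
  | node i y n hy hn =>
    obtain ⟨h0, h1⟩ := hp i
    have hy' := hy (R.erase i) (insert i P)
    have hn' := hn (R.erase i) (insert i P)
    simp only [treeMean_node, pathWeight, treeMean_const_mul]
    by_cases hb : IsBoosted p g (R.erase i) P i
    · simp only [hb, if_true, Bool.false_eq_true, if_false]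
      -- The unnormalised factor has mean `p i * L + (1 - p i) = 1 + (L - 1) * p i`, which the
      -- exponential dominates.
      have hexp : (1 + (L - 1) * p i) * Real.exp (-((L - 1) * p i)) ≤ 1 := by
        rw [Real.exp_neg, ← div_eq_mul_inv, div_le_one (Real.exp_pos _), add_comm]
        exact Real.add_one_le_exp _
      set e := Real.exp (-((L - 1) * p i))
      have he : 0 < e := Real.exp_pos _
      have h2 : p i * (L * e * treeMean p (pathWeight p g L (R.erase i) (insert i P)) y) ≤
          p i * (L * e * 1) := by gcongr
      have h3 : (1 - p i) * (1 * e * treeMean p (pathWeight p g L (R.erase i) (insert i P)) n) ≤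
          (1 - p i) * (1 * e * 1) := by
        have : 0 ≤ 1 - p i := sub_nonneg.2 h1
        gcongr
      linarith
    · simp only [hb, if_false, one_mul]
      nlinarith

/-- The advice for a path: scanning it backwards, an element of `B` that is not boosted by the
advice found so far is added to the advice. -/
lemma exists_advice {U : Type} [DecidableEq U] {p : U → ℝ} (hp : ∀ i, p i ∈ Set.Icc (0 : ℝ) 1)
    {g : Finset U → ℝ} (hg : Monotone g) {L : ℝ} (hL : 1 ≤ L)
    (l : List (U × Bool)) (P B : Finset U) (hl : (probedSeq l).Nodup)
    (hP : ∀ i ∈ probedSeq l, i ∉ P) (hB : B ⊆ activeSet l) :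
    ∃ R ⊆ B, ∃ β : ℝ, 0 ≤ β ∧
      L ^ B.card ≤ L ^ R.card * Real.exp ((L - 1) * β) * pathWeight p g L R P l ∧
      nonadaptiveReward p (fun A => g (A ∪ R)) P + β / 2 ≤
        nonadaptiveReward p g (P ∪ (probedSeq l).toFinset) + R.card / 2 := by
  induction l generalizing P B with
  | nil =>
    obtain rfl : B = ∅ := by simpa [activeSet] using hB
    exact ⟨∅, subset_rfl, 0, le_rfl, by simp [pathWeight], by simp [probedSeq]⟩
  | cons a l ih =>
    obtain ⟨i, a⟩ := a
    simp only [probedSeq, List.map_cons, List.nodup_cons] at hl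
    have hiP : i ∉ P := hP i (by simp [probedSeq])
    obtain ⟨h0, h1⟩ := hp i
    have hBi : B.erase i ⊆ activeSet l := by
      intro j hj
      have := hB (Finset.mem_of_mem_erase hj)
      rw [activeSet_cons] at this
      split_ifs at this
      · exact (Finset.mem_insert.1 this).resolve_left (Finset.ne_of_mem_erase hj)
      · exact this
    have hil : i ∉ activeSet l := fun h => hl.1 (by
      simpa [probedSeq] using activeSet_subset_probedSeq l h)
    obtain ⟨R, hRB, β, hβ, hw, hN⟩ := ih (insert i P) (B.erase i) hl.2 (fun j hj => by
        have hj' := hP j (by simp only [probedSeq, List.map_cons, List.mem_cons]; exact Or.inr hj)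
        simp only [Finset.mem_insert, not_or]
        exact ⟨fun h => hl.1 (h ▸ hj), hj'⟩) hBi
    -- The advice from the tail avoids `i`, so erasing `i` in the forward definition of `pathWeight`
    -- restores exactly the advice known to the backward scan.
    have hiR : i ∉ R := fun h => Finset.notMem_erase i B (hRB h)
    have hRB' : R ⊆ B := hRB.trans (Finset.erase_subset _ _)
    have hRe : R.erase i = R := Finset.erase_eq_of_notMem hiR
    have hmono : Monotone fun A : Finset U => g (A ∪ R) := fun A A' h =>
      hg (Finset.union_subset_union_left h)
    have hins := nonadaptiveReward_insert p (fun A => g (A ∪ R)) hiP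
    have hle := nonadaptiveReward_le_insert hp hmono hiP
    have hPl : insert i P ∪ (probedSeq l).toFinset =
        P ∪ (probedSeq ((i, a) :: l)).toFinset := by
      simp [probedSeq, Finset.insert_union]
    rw [hPl] at hN
    simp only [Finset.insert_union] at hins
    set W := pathWeight p g L R (insert i P) l with hW
    have hW0 : 0 ≤ W := pathWeight_nonneg p g hL _ _ _
    have hLp : 0 < L := zero_lt_one.trans_le hL
    -- If `i` is boosted, probing it raises the potential by at least `p i / 2`, which pays for
    -- adding `p i` to `β`. If it is unboosted and in `B`, adding it to the advice costs less than
    -- `1 / 2`, which the term `R.card / 2` absorbs.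
    by_cases hb : IsBoosted p g R P i
    · have hweight : pathWeight p g L R P ((i, a) :: l) =
          (if a then L else 1) * Real.exp (-((L - 1) * p i)) * W := by
        rw [pathWeight, hRe, if_pos hb]
      refine ⟨R, hRB', β + p i, by linarith, ?_, ?_⟩
      · have hexp : Real.exp ((L - 1) * (β + p i)) * Real.exp (-((L - 1) * p i)) =
            Real.exp ((L - 1) * β) := by rw [← Real.exp_add]; ring_nf
        have hval : L ^ R.card * Real.exp ((L - 1) * (β + p i)) *
            pathWeight p g L R P ((i, a) :: l) =
            (if a then L else 1) * (L ^ R.card * Real.exp ((L - 1) * β) * W) := by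
          rw [hweight, ← hexp]; ring
        rw [hval]
        by_cases hiB : i ∈ B
        · have ha : a = true := by
            have := hB hiB
            rw [activeSet_cons] at this
            split_ifs at this with ha
            · exact ha
            · exact absurd this hil
          rw [if_pos ha, ← Finset.card_erase_add_one hiB, pow_succ']
          gcongr
        · rw [Finset.erase_eq_of_notMem hiB] at hw
          have h1a : (1 : ℝ) ≤ if a then L else 1 := by split_ifs <;> linarith
          exact hw.trans (le_mul_of_one_le_left (by positivity) h1a)
      · unfold IsBoosted at hb
        nlinarith
    · by_cases hiB : i ∈ B
      · have hRe' : (insert i R).erase i = R := Finset.erase_insert hiR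
        have hweight : pathWeight p g L (insert i R) P ((i, a) :: l) = W := by
          rw [pathWeight, hRe', if_neg hb, one_mul]
        refine ⟨insert i R, Finset.insert_subset hiB hRB', β, hβ, ?_, ?_⟩
        · rw [hweight, ← Finset.card_erase_add_one hiB, Finset.card_insert_of_notMem hiR, pow_succ',
            pow_succ', mul_assoc, mul_assoc, ← mul_assoc (L ^ _)]
          gcongr
        · rw [Finset.card_insert_of_notMem hiR]
          simp only [Finset.union_insert]
          unfold IsBoosted at hb
          push_cast
          linarith
      · rw [Finset.erase_eq_of_notMem hiB] at hw
        have hweight : pathWeight p g L R P ((i, a) :: l) = W := by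
          rw [pathWeight, hRe, if_neg hb, one_mul]
        exact ⟨R, hRB', β, hβ, by rwa [hweight], by linarith⟩

/-- The adaptive reward of a rank-like objective. -/
lemma treeMean_rankLike_le {U : Type} [Fintype U] [DecidableEq U] {p : U → ℝ}
    (hp : ∀ i, p i ∈ Set.Icc (0 : ℝ) 1) {g : Finset U → ℝ} (hg : Monotone g)
    (hgB : ∀ A, ∃ B ⊆ A, g A ≤ B.card ∧ ∀ R ⊆ B, (R.card : ℝ) ≤ g R)
    {M : ℝ} (hM : 1 / 2 ≤ M) {T : StrategyTree U}
    (hT : ∀ l ∈ T.leaves, (probedSeq l).Nodup)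
    (hN : ∀ l ∈ T.leaves, nonadaptiveReward p g (probedSeq l).toFinset ≤ M)
    {L : ℝ} (hL : 1 < L) (hU : 0 < Fintype.card U) :
    Real.log L * treeMean p (fun l => g (activeSet l)) T ≤
      2 * M * (Real.log L + L + Real.log (Fintype.card U)) := by
  set N : ℝ := (Fintype.card U : ℝ) with hNdef
  have hN1 : 1 ≤ N := by rw [hNdef]; exact_mod_cast hU
  have hN0 : 0 < N := by linarith
  have hlog : 0 < Real.log L := Real.log_pos hL
  have hL0 : 0 < L := by linarith
  set c : ℝ := Real.exp (2 * M * (Real.log L + (L - 1) + Real.log N)) with hc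
  have hc0 : 0 < c := Real.exp_pos _
  -- The `- 1` is available because `c` has `L - 1` in place of `L` and `2 * M ≥ 1`; it later
  -- absorbs the mean of the likelihood term.
  have hleaf : ∀ l ∈ T.leaves, Real.log L * g (activeSet l) ≤
      (2 * M * (Real.log L + L + Real.log N) - 1) +
        Real.exp (-1) * ∑ R : Finset U, N⁻¹ ^ R.card * pathWeight p g L R ∅ l := by
    intro l hl
    obtain ⟨B, hBA, hgAB, hBR⟩ := hgB (activeSet l)
    obtain ⟨R, hRB, β, hβ, hw, hpot⟩ :=
      exists_advice hp hg hL.le l ∅ B (hT l hl) (by simp) hBA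
    rw [nonadaptiveReward_empty, Finset.empty_union, Finset.empty_union] at hpot
    -- At the root the potential is `g R`, which is at least `R.card` because `R ⊆ B`.
    have hRM : (R.card : ℝ) + β ≤ 2 * M := by linarith [hBR R hRB, hN l hl]
    have hW0 := pathWeight_nonneg p g hL.le R ∅ l
    have hlogN : 0 ≤ Real.log N := Real.log_nonneg hN1
    have hc_le : L ^ R.card * Real.exp ((L - 1) * β) ≤ c * N⁻¹ ^ R.card := by
      rw [← Real.exp_log hL0, ← Real.exp_log (inv_pos.2 hN0), ← Real.exp_nat_mul,
        ← Real.exp_nat_mul, ← Real.exp_add, hc, ← Real.exp_add, Real.exp_log hL0, Real.log_inv]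
      apply Real.exp_le_exp.2
      have hR0 : (0 : ℝ) ≤ R.card := Nat.cast_nonneg _
      nlinarith [mul_nonneg hlog.le (show 0 ≤ 2 * M - R.card by linarith),
        mul_nonneg (sub_nonneg.2 hL.le) (show 0 ≤ 2 * M - β by linarith),
        mul_nonneg hlogN (show 0 ≤ 2 * M - R.card by linarith)]
    have hsum : N⁻¹ ^ R.card * pathWeight p g L R ∅ l ≤
        ∑ R : Finset U, N⁻¹ ^ R.card * pathWeight p g L R ∅ l :=
      Finset.single_le_sum (f := fun R : Finset U => N⁻¹ ^ R.card * pathWeight p g L R ∅ l)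
        (fun R _ => mul_nonneg (by positivity) (pathWeight_nonneg p g hL.le R ∅ l))
        (Finset.mem_univ R)
    set S := ∑ R : Finset U, N⁻¹ ^ R.card * pathWeight p g L R ∅ l
    have hBS : L ^ B.card ≤ c * S := by
      calc L ^ B.card ≤ L ^ R.card * Real.exp ((L - 1) * β) * pathWeight p g L R ∅ l := hw
        _ ≤ c * N⁻¹ ^ R.card * pathWeight p g L R ∅ l := by gcongr
        _ = c * (N⁻¹ ^ R.card * pathWeight p g L R ∅ l) := by ring
        _ ≤ c * S := by gcongr
    have hS0 : 0 < S := by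
      by_contra h
      nlinarith [pow_pos hL0 B.card]
    have h1 : (B.card : ℝ) * Real.log L ≤ Real.log c + Real.log S := by
      rw [← Real.log_pow, ← Real.log_mul hc0.ne' hS0.ne']
      exact Real.log_le_log (by positivity) hBS
    -- The tangent to `log` at `e` stands in for Jensen's inequality.
    have h2 : Real.log S ≤ Real.exp (-1) * S := by
      have := Real.log_le_sub_one_of_pos (mul_pos (Real.exp_pos (-1)) hS0)
      rw [Real.log_mul (Real.exp_pos _).ne' hS0.ne', Real.log_exp] at this
      linarith
    rw [hc, Real.log_exp] at h1
    nlinarith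
  have hmean := treeMean_mono hp hleaf
  rw [treeMean_const_mul, treeMean_add, treeMean_const, treeMean_const_mul, treeMean_sum] at hmean
  have hsum : ∑ R : Finset U, treeMean p (fun l => N⁻¹ ^ R.card * pathWeight p g L R ∅ l) T ≤
      Real.exp 1 := by
    calc _ ≤ ∑ R : Finset U, N⁻¹ ^ R.card := by
          refine Finset.sum_le_sum fun R _ => ?_
          rw [treeMean_const_mul]
          exact mul_le_of_le_one_right (by positivity)
            (treeMean_pathWeight_le_one hp g hL.le R ∅ T)
      _ = (N⁻¹ + 1) ^ Fintype.card U := by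
          rw [← Finset.card_univ, ← Finset.sum_pow_mul_eq_add_pow]
          simp
      _ ≤ Real.exp N⁻¹ ^ Fintype.card U := by
          gcongr
          exact Real.add_one_le_exp _
      _ = Real.exp 1 := by
          rw [← Real.exp_nat_mul, ← hNdef, mul_inv_cancel₀ hN0.ne']
  have : Real.exp (-1) * ∑ R : Finset U,
      treeMean p (fun l => N⁻¹ ^ R.card * pathWeight p g L R ∅ l) T ≤ 1 := by
    calc _ ≤ Real.exp (-1) * Real.exp 1 := by gcongr
      _ = 1 := by rw [← Real.exp_add]; simp
  linarith

/-! ### XOS objectives -/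

/-- The largest number of elements of `X` whose weight is at least `θ` in one weight vector. -/
noncomputable def thresholdRank {U : Type} {W : ℕ} (w : Fin W → U → ℝ) (θ : ℝ)
    (X : Finset U) : ℝ :=
  ((Finset.univ.sup fun k => (X.filter fun i => θ ≤ w k i).card : ℕ) : ℝ)

lemma card_filter_le_thresholdRank {U : Type} {W : ℕ} (w : Fin W → U → ℝ) (θ : ℝ)
    (X : Finset U) (k : Fin W) :
    ((X.filter fun i => θ ≤ w k i).card : ℝ) ≤ thresholdRank w θ X :=
  Nat.cast_le.2 (Finset.le_sup (f := fun k => (X.filter fun i => θ ≤ w k i).card)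
    (Finset.mem_univ k))

lemma exists_thresholdRank_eq {U : Type} {W : ℕ} [Nonempty (Fin W)] (w : Fin W → U → ℝ) (θ : ℝ)
    (X : Finset U) : ∃ k, thresholdRank w θ X = (X.filter fun i => θ ≤ w k i).card := by
  obtain ⟨k, -, hk⟩ := Finset.exists_mem_eq_sup (Finset.univ : Finset (Fin W))
    Finset.univ_nonempty fun k => (X.filter fun i => θ ≤ w k i).card
  exact ⟨k, by rw [thresholdRank, hk]⟩

lemma thresholdRank_mono {U : Type} {W : ℕ} (w : Fin W → U → ℝ) (θ : ℝ) :
    Monotone (thresholdRank w θ) := fun _ _ h =>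
  Nat.cast_le.2 (Finset.sup_mono_fun fun _ _ =>
    Finset.card_le_card (Finset.filter_subset_filter _ h))

/-- The elements counted by one optimal weight vector remain counted by it in every subset; this is
the rank-like property needed for the advice. -/
lemma exists_subset_thresholdRank {U : Type} {W : ℕ} [Nonempty (Fin W)] (w : Fin W → U → ℝ)
    (θ : ℝ) (A : Finset U) :
    ∃ B ⊆ A, thresholdRank w θ A ≤ B.card ∧ ∀ R ⊆ B, (R.card : ℝ) ≤ thresholdRank w θ R := by
  obtain ⟨k, hk⟩ := exists_thresholdRank_eq w θ A
  refine ⟨A.filter fun i => θ ≤ w k i, Finset.filter_subset _ _, hk.le, fun R hR => ?_⟩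
  have h := card_filter_le_thresholdRank w θ R k
  rwa [Finset.filter_true_of_mem fun i hi => (Finset.mem_filter.1 (hR hi)).2] at h

lemma mul_thresholdRank_le {U : Type} {W : ℕ} [Nonempty (Fin W)] {w : Fin W → U → ℝ}
    (hw : ∀ k j, 0 ≤ w k j) {f : Finset U → ℝ} (hf : ∀ S k, ∑ j ∈ S, w k j ≤ f S) {θ : ℝ}
    (X : Finset U) : θ * thresholdRank w θ X ≤ f X := by
  obtain ⟨k, hk⟩ := exists_thresholdRank_eq w θ X
  calc θ * thresholdRank w θ X = (X.filter fun i => θ ≤ w k i).card • θ := by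
        rw [hk, nsmul_eq_mul, mul_comm]
    _ ≤ ∑ i ∈ X.filter fun i => θ ≤ w k i, w k i :=
        Finset.card_nsmul_le_sum _ _ _ fun i hi => (Finset.mem_filter.1 hi).2
    _ ≤ ∑ i ∈ X, w k i :=
        Finset.sum_le_sum_of_subset_of_nonneg (Finset.filter_subset _ _) fun i _ _ => hw k i
    _ ≤ f X := hf X k

/-- Dyadic layers of a weight below `2 ^ J * θ`. -/
lemma le_add_sum_dyadic {θ x : ℝ} (hθ : 0 ≤ θ) (J : ℕ) (hx : x ≤ 2 ^ J * θ) :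
    x ≤ θ + ∑ j ∈ Finset.range J, 2 ^ j * θ * if 2 ^ j * θ ≤ x then 1 else 0 := by
  induction J with
  | zero => simpa using hx
  | succ J ih =>
    rw [Finset.sum_range_succ]
    by_cases h : 2 ^ J * θ ≤ x
    -- All layers are present and sum with `θ` to `2 ^ J * θ`; the top layer doubles this to the
    -- assumed bound on `x`.
    · have h2 : ∀ j ∈ Finset.range J,
          2 ^ j * θ * (if 2 ^ j * θ ≤ x then 1 else 0) = 2 ^ j * θ := fun j hj => by
        rw [if_pos, mul_one]
        refine le_trans ?_ h
        have := Finset.mem_range.1 hj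
        gcongr
        norm_num
      rw [Finset.sum_congr rfl h2, ← Finset.sum_mul, geom_sum_eq (by norm_num), if_pos h]
      rw [pow_succ] at hx
      linarith
    · simpa [h] using ih (not_le.1 h).le

/-- The layers of an XOS objective: light elements, dyadic weight classes and heavy elements. -/
lemma xos_le_layers {U : Type} {W : ℕ} {w : Fin W → U → ℝ} {f : Finset U → ℝ}
    (hf : ∀ S k, ∑ j ∈ S, w k j ≤ f S) (hf' : ∀ S, ∃ k, ∑ j ∈ S, w k j = f S) {θ : ℝ}
    (hθ : 0 ≤ θ) (J : ℕ) (A : Finset U) :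
    f A ≤ A.card * θ + ∑ j ∈ Finset.range J, 2 ^ j * θ * thresholdRank w (2 ^ j * θ) A +
      ∑ i ∈ A, if 2 ^ J * θ ≤ f {i} then f {i} else 0 := by
  obtain ⟨k, hk⟩ := hf' A
  have hpt : ∀ i ∈ A, w k i ≤
      θ + (∑ j ∈ Finset.range J, 2 ^ j * θ * if 2 ^ j * θ ≤ w k i then 1 else 0) +
        if 2 ^ J * θ ≤ f {i} then f {i} else 0 := fun i _ => by
    have hwi : w k i ≤ f {i} := by simpa using hf {i} k
    have hnn : 0 ≤ ∑ j ∈ Finset.range J, 2 ^ j * θ * if 2 ^ j * θ ≤ w k i then (1 : ℝ) else 0 :=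
      Finset.sum_nonneg fun j _ => by split_ifs <;> positivity
    split_ifs with h
    · linarith
    · linarith [le_add_sum_dyadic hθ J (hwi.trans (not_le.1 h).le)]
  rw [← hk]
  refine (Finset.sum_le_sum hpt).trans ?_
  rw [Finset.sum_add_distrib, Finset.sum_add_distrib, Finset.sum_const, nsmul_eq_mul,
    Finset.sum_comm]
  gcongr with j _
  rw [← Finset.mul_sum]
  gcongr
  simpa [Finset.sum_boole] using card_filter_le_thresholdRank w (2 ^ j * θ) A k

/-! ### The adaptivity gap -/

/-- With `x = log₂ n` this lets the additive losses be absorbed into the factor `log n / log log n`.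
-/
lemma one_le_div_logb {x : ℝ} (hx : 1 < x) : 1 ≤ x / Real.logb 2 x := by
  have hlog : 0 < Real.logb 2 x := Real.logb_pos (by norm_num) hx
  rw [le_div_iff₀ hlog, one_mul, Real.logb, div_le_iff₀ (Real.log_pos (by norm_num))]
  have h1 : Real.log x ≤ x / 2 := by
    have := Real.log_le_sub_one_of_pos (show 0 < x / 2 by linarith)
    rw [Real.log_div (by linarith) (by norm_num)] at this
    linarith [Real.log_two_lt_d9]
  nlinarith [Real.log_two_gt_d9]

lemma adaptiveReward_le {n r : ℕ} (hn : 3 ≤ n) (hr : 2 ≤ r) {p : Fin n → ℝ}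
    (hp : ∀ i, p i ∈ Set.Icc (0 : ℝ) 1) {F : Set (List (Fin n))}
    (hF : IsPrefixClosedConstraint F) (hFr : ∀ P ∈ F, P.length ≤ r) {f : Finset (Fin n) → ℝ}
    (hf : IsXOS f) {M : ℝ} (hM : 0 < M) (hNA : ∀ P ∈ F, nonadaptiveReward p f P.toFinset ≤ M)
    {T : StrategyTree (Fin n)} (hT : T.IsFeasible F) :
    adaptiveReward p f T ≤
      33 * (Real.logb 2 r * (Real.logb 2 n / Real.logb 2 (Real.logb 2 n))) * M := by
  obtain ⟨W, w, hw, hmax⟩ := hf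
  have hle : ∀ S k, ∑ j ∈ S, w k j ≤ f S := fun S k => (hmax S).2 ⟨k, rfl⟩
  have heq : ∀ S, ∃ k, ∑ j ∈ S, w k j = f S := fun S => (hmax S).1
  have hne : Nonempty (Fin W) := ⟨(heq ∅).choose⟩
  have hf0 : ∀ S, 0 ≤ f S := fun S => by
    obtain ⟨k, hk⟩ := heq S
    exact hk ▸ Finset.sum_nonneg fun j _ => hw k j
  have hmono : Monotone f := fun S S' h => by
    obtain ⟨k, hk⟩ := heq S
    rw [← hk]
    exact (Finset.sum_le_sum_of_subset_of_nonneg h fun j _ _ => hw k j).trans (hle S' k)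
  have hr0 : (0 : ℝ) < r := by positivity
  set L := Real.logb 2 n with hLdef
  have hL1 : 1 < L := by
    rw [hLdef, Real.lt_logb_iff_rpow_lt (by norm_num) (by positivity), Real.rpow_one]
    exact_mod_cast hn
  set ρ := L / Real.logb 2 L with hρ
  have hρ1 : 1 ≤ ρ := one_le_div_logb hL1
  have hlogL : 0 < Real.log L := Real.log_pos hL1
  have hρlog : L = ρ * (Real.log L / Real.log 2) := by
    rw [hρ, Real.logb, div_mul_cancel₀]
    exact (div_pos hlogL (Real.log_pos (by norm_num))).ne'
  have hlogn : Real.log n ≤ L := by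
    rw [hLdef, Real.logb, le_div_iff₀ (Real.log_pos (by norm_num))]
    have : 0 ≤ Real.log n := Real.log_natCast_nonneg n
    nlinarith [Real.log_two_lt_d9]
  set θ := M / r with hθdef
  have hθ : 0 < θ := div_pos hM hr0
  have hrθ : r * θ = M := by rw [hθdef]; field_simp
  -- One extra power lifts `2 ^ J` above `r`, the other lifts the top threshold above `2 * M`.
  set J := Nat.log 2 r + 2 with hJ
  have hJtop : 2 * M ≤ 2 ^ J * θ := by
    have h : (r : ℝ) ≤ 2 ^ (Nat.log 2 r + 1) := by
      exact_mod_cast (Nat.lt_pow_succ_log_self (by norm_num) r).le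
    rw [← hrθ, hJ, pow_succ, mul_comm _ (2 : ℝ), mul_assoc]
    gcongr
  have hlog2r : 1 ≤ Real.logb 2 r := by
    rw [Real.le_logb_iff_rpow_le (by norm_num) hr0, Real.rpow_one]
    exact_mod_cast hr
  have hJle : (J : ℝ) ≤ 3 * Real.logb 2 r := by
    have := Real.natLog_le_logb r 2
    push_cast [hJ] at this ⊢
    linarith
  have hnodup : ∀ l ∈ T.leaves, (probedSeq l).Nodup := fun l hl => hF.nodup _ (hT l hl)
  have hclass : ∀ j ∈ Finset.range J,
      2 ^ j * θ * treeMean p (fun l => thresholdRank w (2 ^ j * θ) (activeSet l)) T ≤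
        10 * ρ * M := by
    intro j hj
    have hj0 : 0 < 2 ^ j * θ := by positivity
    -- This gives the scaled bound `M / (2 ^ j * θ)` the value at least `1 / 2` that
    -- `treeMean_rankLike_le` requires.
    have hjM : 2 ^ j * θ ≤ 2 * M := by
      have h1 : (2 : ℝ) ^ j ≤ 2 ^ (Nat.log 2 r + 1) := by
        have := Finset.mem_range.1 hj
        gcongr
        · norm_num
        · omega
      have h2 : (2 : ℝ) ^ Nat.log 2 r ≤ r := by
        exact_mod_cast Nat.pow_log_le_self 2 (by omega)
      rw [← hrθ, ← mul_assoc]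
      gcongr
      rw [pow_succ] at h1
      linarith
    have hN : ∀ l ∈ T.leaves, nonadaptiveReward p (thresholdRank w (2 ^ j * θ))
        (probedSeq l).toFinset ≤ M / (2 ^ j * θ) := fun l hl => by
      rw [le_div_iff₀ hj0, mul_comm, ← nonadaptiveReward_const_mul]
      exact (nonadaptiveReward_mono hp (fun A => mul_thresholdRank_le hw hle A) _).trans
        (hNA _ (hT l hl))
    have h := treeMean_rankLike_le hp (thresholdRank_mono w (2 ^ j * θ))
      (exists_subset_thresholdRank w (2 ^ j * θ))
      (M := M / (2 ^ j * θ)) (by rw [le_div_iff₀ hj0]; linarith) hnodup hN hL1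
      (by rw [Fintype.card_fin]; omega)
    rw [Fintype.card_fin] at h
    set E := treeMean p (fun l => thresholdRank w (2 ^ j * θ) (activeSet l)) T
    have hm : 0 < M / (2 ^ j * θ) := div_pos hM hj0
    have hLb : L ≤ 2 * ρ * Real.log L := by
      have : Real.log L / Real.log 2 ≤ 2 * Real.log L := by
        rw [div_le_iff₀ (Real.log_pos (by norm_num))]
        nlinarith [Real.log_two_gt_d9]
      nlinarith
    have h' : Real.log L * E ≤ Real.log L * (10 * ρ * (M / (2 ^ j * θ))) := by
      refine h.trans ?_
      -- The first term is at most `ρ * log L`; each of the other two is at most `L ≤ 2 * ρ * log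
      -- L`.
      have : Real.log L + L + Real.log n ≤ 5 * ρ * Real.log L := by nlinarith
      calc _ ≤ 2 * (M / (2 ^ j * θ)) * (5 * ρ * Real.log L) := by gcongr
        _ = _ := by ring
    have hE := le_of_mul_le_mul_left h' hlogL
    calc 2 ^ j * θ * E ≤ 2 ^ j * θ * (10 * ρ * (M / (2 ^ j * θ))) := by gcongr
      _ = 10 * ρ * M := by field_simp
  set v : Fin n → ℝ := fun i => if 2 * M ≤ f {i} then f {i} else 0 with hv
  have hv0 : ∀ i, 0 ≤ v i := fun i => by
    simp only [hv]; split_ifs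
    · exact hf0 _
    · exact le_rfl
  have hheavy : treeMean p (activeTotal v) T ≤ 2 * M := by
    rw [treeMean_activeTotal, ← treeMean_const p (2 * M) T]
    refine treeMean_mono hp fun l hl => ?_
    have h := probedTotal_large_le (M := M) hp hmono l ∅ (hnodup l hl) (by simp)
      (by rw [Finset.empty_union]; exact hNA _ (hT l hl))
    rw [nonadaptiveReward_empty] at h
    simp only [hv]
    linarith [hf0 ∅]
  have hleaf : ∀ l ∈ T.leaves, f (activeSet l) ≤
      M + ∑ j ∈ Finset.range J, 2 ^ j * θ * thresholdRank w (2 ^ j * θ) (activeSet l) +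
        activeTotal v l := by
    intro l hl
    refine (xos_le_layers hle heq hθ.le J _).trans ?_
    have hcard : ((activeSet l).card : ℝ) ≤ r := by
      exact_mod_cast (Finset.card_le_card (activeSet_subset_probedSeq l)).trans
        ((List.toFinset_card_le _).trans (hFr _ (hT l hl)))
    gcongr
    · rw [← hrθ]; gcongr
    · refine (Finset.sum_le_sum fun i _ => ?_).trans (sum_activeSet_le_activeTotal hv0 l)
      simp only [hv]
      split_ifs with h1 h2
      · exact le_rfl
      · exact absurd (hJtop.trans h1) h2
      · exact hf0 _
      · exact le_rfl
  have hmean := treeMean_mono hp hleaf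
  rw [treeMean_add, treeMean_add, treeMean_const, treeMean_sum] at hmean
  simp only [treeMean_const_mul] at hmean
  have hsum := Finset.sum_le_sum hclass
  rw [Finset.sum_const, Finset.card_range, nsmul_eq_mul] at hsum
  have hadapt : adaptiveReward p f T = treeMean p (fun l => f (activeSet l)) T := rfl
  rw [hadapt]
  have h1 : (J : ℝ) * (10 * ρ * M) ≤ 3 * Real.logb 2 r * (10 * ρ * M) := by gcongr
  have h2 : 1 ≤ Real.logb 2 r * ρ := one_le_mul_of_one_le_of_one_le hlog2r hρ1
  -- The constant is `33 = 3 * 10 + 1 + 2`: dyadic classes, light weights, heavy elements.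
  nlinarith

/-- A bound on adaptive rewards that is linear in every bound on the non-adaptive rewards bounds
the adaptivity gap. -/
lemma adaptivityGap_le {U : Type} [DecidableEq U] {p : U → ℝ} {F : Set (List U)}
    {f : Finset U → ℝ} {K : ℝ} (hK : 0 ≤ K)
    (hbdd : ∃ B : ℝ, ∀ P ∈ F, nonadaptiveReward p f P.toFinset ≤ B)
    (h : ∀ M : ℝ, 0 < M → (∀ P ∈ F, nonadaptiveReward p f P.toFinset ≤ M) →
      ∀ T : StrategyTree U, T.IsFeasible F → adaptiveReward p f T ≤ K * M) :
    adaptivityGap p F f ≤ ENNReal.ofReal K := by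
  refine ENNReal.div_le_of_le_mul (iSup₂_le fun T hT => ?_)
  obtain ⟨B, hB⟩ := hbdd
  have hfin : optNonadaptive p F f ≠ ∞ :=
    ((iSup₂_le fun P hP => ENNReal.ofReal_le_ofReal (hB P hP)).trans_lt
      ENNReal.ofReal_lt_top).ne
  set m := (optNonadaptive p F f).toReal with hm
  have hm0 : 0 ≤ m := ENNReal.toReal_nonneg
  have hNA : ∀ P ∈ F, nonadaptiveReward p f P.toFinset ≤ m := fun P hP =>
    (ENNReal.ofReal_le_iff_le_toReal hfin).1
      (le_iSup₂_of_le (f := fun (P : List U) (_ : P ∈ F) =>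
        ENNReal.ofReal (nonadaptiveReward p f P.toFinset)) P hP le_rfl)
  have hKm : adaptiveReward p f T ≤ K * m := by
    -- The optimum `m` may be `0` while `h` asks for a positive bound, so `m` is perturbed; dividing
    -- by `K + 1` also covers `K = 0`.
    refine le_of_forall_pos_le_add fun ε hε => ?_
    have hK1 : 0 < K + 1 := by linarith
    have := h (m + ε / (K + 1)) (by positivity)
      (fun P hP => (hNA P hP).trans (by linarith [div_pos hε hK1])) T hT
    have h2 : K * (ε / (K + 1)) ≤ ε := by
      rw [mul_div_assoc', div_le_iff₀ hK1]
      nlinarith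
    linarith
  calc ENNReal.ofReal (adaptiveReward p f T) ≤ ENNReal.ofReal (K * m) :=
        ENNReal.ofReal_le_ofReal hKm
    _ = ENNReal.ofReal K * optNonadaptive p F f := by
        rw [ENNReal.ofReal_mul hK, hm, ENNReal.ofReal_toReal hfin]

end StochasticProbing

theorem mainTheorem5 :
    ∃ C : ℝ, 0 < C ∧ ∀ n r : ℕ, 3 ≤ n → 2 ≤ r → r ≤ n →
      StochasticProbing.xosGap n r ≤
        ENNReal.ofReal
          (C * (Real.logb 2 r * (Real.logb 2 n / Real.logb 2 (Real.logb 2 n)))) := by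
  refine ⟨33, by norm_num, fun n r hn hr _ => sSup_le ?_⟩
  rintro _ ⟨p, F, f, hp, hF, hFr, hf, rfl⟩
  have hL : 1 < Real.logb 2 n := by
    rw [Real.lt_logb_iff_rpow_lt (by norm_num) (by positivity), Real.rpow_one]
    exact_mod_cast hn
  have hlog2r : 0 ≤ Real.logb 2 r :=
    Real.logb_nonneg (by norm_num) (by exact_mod_cast (by omega : 1 ≤ r))
  have hρ := StochasticProbing.one_le_div_logb hL
  refine StochasticProbing.adaptivityGap_le (by positivity) ?_ fun M hM hNA T hT =>
    StochasticProbing.adaptiveReward_le hn hr hp hF hFr hf hM hNA hT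
  -- Only finitely many sets can be probed, so the non-adaptive optimum is finite.
  obtain ⟨B, hB⟩ := (Set.finite_range fun S : Finset (Fin n) =>
    StochasticProbing.nonadaptiveReward p f S).bddAbove
  exact ⟨B, fun P _ => hB ⟨P.toFinset, rfl⟩⟩
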